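/- Let $\Omega\subset\mathbb R^2$ be a nonempty bounded convex domain (in particular with Lipschitz boundary), let $\varepsilon_a\le\varepsilon_b$ in $\mathbb R^2$ (componentwise), and let $E_{ad}=\{\varepsilon\in L^2(\Omega)^2:\ \varepsilon_a\le\varepsilon(x)\le\varepsilon_b\ \text{for a.a. }x\in\Omega\}$. Let $\alpha_{\max}\ge 0$ and let $\varphi_1,\dots,\varphi_K:\mathbb R^2\to\mathbb R^2$ satisfy, for every $j$: (i) $\varphi_j$ is continuously differentiable; (ii) there are vectors $c_j<C_j$ in $\mathbb R^2$ with positive entries such that $c_j\le\varphi_j(y)\le C_j$ (componentwise) for all $y\in\mathbb R^2$; (iii) $(\varphi_j(y)-\varphi_j(\tilde y))\cdot(y-\tilde y)\ge 0$ for all $y,\tilde y\in\mathbb R^2$. Put $A_K=\{\alpha\in\mathbb R^K: 0\le\alpha_j\le\alpha_{\max}\ \text{for all } j\}$ and $g_\alpha=\sum_{j=1}^K\alpha_j\varphi_j$, and assume that for every $\alpha\in A_K$ the function $g_\alpha$ is continuously differentiable with a positive semidefinite Jacobian matrix at every point. For $1\le k\le K-1$ let $A_k=\{\alpha\in A_K:\alpha_j=0\text{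 for }j>k\}$. For $g:\mathbb R^2\to\mathbb R^2$ and $\varepsilon\in L^2(\Omega)^2$, a weak solution of $-\Delta y+g(y)=\varepsilon$ in $\Omega$, $y=0$ on $\partial\Omega$, is a function $y\in H_0^1(\Omega)^2$ with $$\int_\Omega\langle\nabla y,\nabla v\rangle_F\,dx+\int_\Omega v\cdot g(y)\,dx=\int_\Omega v\cdot\varepsilon\,dx\qquad\text{for all }v\in H_0^1(\Omega)^2 .$$ Theorem. Let $1\le k\le K-1$, let $\varepsilon^1,\dots,\varepsilon^k\in E_{ad}$ and let $c\in\mathbb R$. Then for every $\beta\in A_k$ and $m\in\{1,\dots,k\}$ the problem $-\Delta y+g_\beta(y)=\varepsilon^m$, $y|_{\partial\Omega}=0$, has a unique weak solution $y^{\beta,\varepsilon^m}$, the problem $-\Delta y+\varphi_{k+1}(y)=c\,\varepsilon^m$, $y|_{\partial\Omega}=0$, has a unique weak solution $y^m_{k+1}$, and the fitting-step problem $$\min_{\beta,\,y^1,\dots,y^k}\ \sum_{m=1}^k\tfrac12\|y^m-y^m_{k+1}\|_{L^2(\Omega)^2}^2$$ subject to $\beta\in A_k$ and, for $m=1,\dots,k$,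 $y^m$ being a weak solution of $-\Delta y^m+g_\beta(y^m)=\varepsilon^m$ in $\Omega$, $y^m|_{\partial\Omega}=0$, has at least one solution $(\bar\beta,\bar y^1,\dots,\bar y^k)$ with $\bar\beta\in A_k$. Equivalently, $\beta\mapsto\sum_{m=1}^k\frac12\|y^{\beta,\varepsilon^m}-y^m_{k+1}\|_{L^2(\Omega)^2}^2$ attains its minimum over $A_k$. -/

import Mathlib

open MeasureTheory Set
open scoped ENNReal ContDiff

noncomputable section

namespace SemilinearFitting

/-- The Euclidean plane, both as the space containing the domain and as the space of values. -/
abbrev Plane : Type := EuclideanSpace ℝ (Fin 2)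

/-- Real test functions: smooth with compact support contained in `Ω`. -/
structure IsTestFunction (Ω : Set Plane) (ψ : Plane → ℝ) : Prop where
  smooth : ContDiff ℝ ∞ ψ
  compact_support : HasCompactSupport ψ
  support_subset : tsupport ψ ⊆ Ω

/-- `G` is the weak gradient of `u` on `Ω`:
`∫_Ω u ∂ᵢψ = - ∫_Ω Gᵢ ψ` for all test functions `ψ` and `i = 1, 2`. -/
def HasWeakGradient (Ω : Set Plane) (u : Plane → ℝ) (G : Plane → Plane) : Prop :=
  ∀ ψ : Plane → ℝ, IsTestFunction Ω ψ → ∀ i : Fin 2,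
    ∫ x in Ω, u x * gradient ψ x i = - ∫ x in Ω, G x i * ψ x

/-- `u` belongs to `H¹(Ω)` and its weak gradient is `G`. -/
structure IsH1 (Ω : Set Plane) (u : Plane → ℝ) (G : Plane → Plane) : Prop where
  memLp : MemLp u 2 (volume.restrict Ω)
  memLp_grad : MemLp G 2 (volume.restrict Ω)
  weak_gradient : HasWeakGradient Ω u G

/-- `u` belongs to `H¹₀(Ω)`, the closure of the test functions in `H¹(Ω)`,
and its weak gradient is `G`. -/
structure IsH10 (Ω : Set Plane) (u : Plane → ℝ) (G : Plane → Plane) : Prop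
    extends IsH1 Ω u G where
  approx : ∀ δ : ℝ≥0∞, 0 < δ → ∃ ψ : Plane → ℝ, IsTestFunction Ω ψ ∧
    eLpNorm (fun x => u x - ψ x) 2 (volume.restrict Ω) < δ ∧
    eLpNorm (fun x => G x - gradient ψ x) 2 (volume.restrict Ω) < δ

/-- The vector-valued function `y` belongs to `H¹₀(Ω) × H¹₀(Ω)`, and the rows of its (weak)
Jacobian matrix are `Dy 0 = ∇y₁` and `Dy 1 = ∇y₂`. -/
def IsVecH10 (Ω : Set Plane) (y : Plane → Plane) (Dy : Fin 2 → Plane → Plane) : Prop :=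
  ∀ i : Fin 2, IsH10 Ω (fun x => y x i) (Dy i)

/-- The space `L²(Ω) × L²(Ω)`, with its Hilbert norm. -/
abbrev VecL2 (Ω : Set Plane) : Type := Lp Plane 2 (volume.restrict Ω)

/-- `y ∈ H¹₀(Ω) × H¹₀(Ω)` is a weak solution of `-Δy + g(y) = ε` in `Ω`, `y = 0` on `∂Ω`:
`∫_Ω ⟨∇y, ∇v⟩_F + ∫_Ω v · g(y) = ∫_Ω v · ε` for all `v ∈ H¹₀(Ω) × H¹₀(Ω)`. -/
def IsWeakSolution (Ω : Set Plane) (g : Plane → Plane) (ε y : VecL2 Ω) : Prop :=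
  ∃ Dy : Fin 2 → Plane → Plane, IsVecH10 Ω y Dy ∧
    ∀ (v : Plane → Plane) (Dv : Fin 2 → Plane → Plane), IsVecH10 Ω v Dv →
      (∫ x in Ω, ∑ i, inner ℝ (Dy i x) (Dv i x)) + ∫ x in Ω, inner ℝ (v x) (g (y x))
        = ∫ x in Ω, inner ℝ (v x) (ε x)

/-- Admissible controls: componentwise bounds `εa ≤ ε(x) ≤ εb` for almost all `x ∈ Ω`. -/
def admissibleControls (Ω : Set Plane) (εa εb : Plane) : Set (VecL2 Ω) :=
  {ε | ∀ᵐ x ∂(volume.restrict Ω), ∀ i, εa i ≤ ε x i ∧ ε x i ≤ εb i}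

/-- The nonlinearity `g_α = ∑ⱼ αⱼ φⱼ`. -/
def nonlinearity {K : ℕ} (φ : Fin K → Plane → Plane) (α : Fin K → ℝ) : Plane → Plane :=
  fun y => ∑ j, α j • φ j y

/-- Admissible coefficients `0 ≤ αⱼ ≤ αmax`. -/
def coeffs (K : ℕ) (αmax : ℝ) : Set (Fin K → ℝ) :=
  {α | ∀ j, 0 ≤ α j ∧ α j ≤ αmax}

/-- Admissible coefficients of which only the first `k` may be nonzero
(indices in `Fin K` start from `0`). -/
def coeffsUpTo (K : ℕ) (αmax : ℝ) (k : ℕ) : Set (Fin K → ℝ) :=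
  {α ∈ coeffs K αmax | ∀ j : Fin K, k ≤ (j : ℕ) → α j = 0}

/-- The assumptions on the basis elements: continuously differentiable, componentwise bounded
from below and above by vectors with positive entries, and monotone. -/
structure BasisAssumption {K : ℕ} (φ : Fin K → Plane → Plane) : Prop where
  contDiff : ∀ j, ContDiff ℝ 1 (φ j)
  bounded : ∀ j, ∃ c C : Plane, (∀ i, 0 < c i ∧ c i < C i) ∧
    ∀ y i, c i ≤ φ j y i ∧ φ j y i ≤ C i
  monotone : ∀ j (y y' : Plane), 0 ≤ inner ℝ (φ j y - φ j y') (y - y')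

/-- The assumption on a nonlinearity: continuously differentiable, with a Jacobian matrix
that is positive semidefinite at every point (in the sense of its quadratic form). -/
structure NonlinearityAssumption (g : Plane → Plane) : Prop where
  contDiff : ContDiff ℝ 1 g
  jacobian_psd : ∀ y v : Plane, 0 ≤ inner ℝ (fderiv ℝ g y v) v

/-- The cost `J(y¹, …, yᵏ) = ∑ₘ ½ ‖yᵐ - zᵐ‖²` in `L²(Ω) × L²(Ω)`, for target states `zᵐ`. -/
def fittingCost {Ω : Set Plane} {k : ℕ} (z y : Fin k → VecL2 Ω) : ℝ :=
  ∑ m, (1 / 2 : ℝ) * ‖y m - z m‖ ^ 2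

/-- Feasibility of `(β, y¹, …, yᵏ)` in the fitting-step problem: `β` is admissible with only the
first `k` coefficients active, and `yᵐ` is a weak solution of `-Δyᵐ + g_β(yᵐ) = εᵐ`,
`yᵐ = 0` on `∂Ω`. -/
def FittingFeasible (Ω : Set Plane) {K : ℕ} (φ : Fin K → Plane → Plane) (αmax : ℝ) {k : ℕ}
    (ε : Fin k → VecL2 Ω) (β : Fin K → ℝ) (y : Fin k → VecL2 Ω) : Prop :=
  β ∈ coeffsUpTo K αmax k ∧ ∀ m, IsWeakSolution Ω (nonlinearity φ β) (ε m) (y m)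

end SemilinearFitting

end

/-! For nonnegative coefficients, `g_β` is continuous, bounded and monotone. On the Hilbert space
`H¹₀(Ω)²` the weak equation reads `T u = 0` with `T = P*P + ι*(N ∘ ι - ε)`, where `P` is the
Jacobian, `ι` the embedding into `L²(Ω)²` and `N` the superposition operator. `T` is monotone and
hemicontinuous, and the Poincaré inequality makes it coercive on a large sphere, so Browder-Minty
gives a state.

Testing the difference of two equations with the difference of their solutions yields one stability
estimate (`norm_sub_variational_solution_le`). With equal nonlinearities it is uniqueness; with
different coefficients it makes the state Lipschitz in `β`. The cost is therefore a continuous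
function of `β` alone on a compact nonempty subset of `ℝᴷ`, and Weierstrass' theorem applies; no
compact embedding of `H¹₀` is needed. -/

noncomputable section

namespace SemilinearFitting

/-! ### Monotone operators: the Browder-Minty theorem. -/

section BrowderMinty

variable {V : Type*} [NormedAddCommGroup V] [InnerProductSpace ℝ V]

/-- Finite-dimensional core of Minty's theorem: a finite monotone family satisfies Minty's
variational inequality at some point of the convex hull. -/
theorem exists_mem_stdSimplex_minty {ι : Type*} [Fintype ι] [Nonempty ι] (v T : ι → V)
    (hmono : ∀ i j, 0 ≤ inner ℝ (T i - T j) (v i - v j)) :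
    ∃ w ∈ stdSimplex ℝ ι, ∀ i, inner ℝ (T i) (∑ j, w j • v j - v i) ≤ 0 := by
  classical
  by_contra! hcon
  -- Linear in `w`, and equal to the Minty expressions when the weights sum to 1. If the claim
  -- fails, the image of the simplex misses the nonpositive orthant and can be separated from it.
  let M : (ι → ℝ) →ₗ[ℝ] (ι → ℝ) :=
    { toFun := fun w i => ∑ j, w j * inner ℝ (T i) (v j - v i)
      map_add' := fun a b => by
        ext i; simp [add_mul, Finset.sum_add_distrib]
      map_smul' := fun a b => by
        ext i; simp [Finset.mul_sum, mul_assoc] }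
  have hM : ∀ w ∈ stdSimplex ℝ ι, ∀ i,
      M w i = inner ℝ (T i) (∑ j, w j • v j - v i) := by
    intro w hw i
    have h1 : (∑ j, w j • v j) - v i = ∑ j, w j • (v j - v i) := by
      simp [smul_sub, Finset.sum_sub_distrib, ← Finset.sum_smul, hw.2]
    rw [h1, inner_sum]
    simp [M, inner_smul_right]
  have hcomp : IsCompact (M '' stdSimplex ℝ ι) :=
    (isCompact_stdSimplex ℝ ι).image M.continuous_of_finiteDimensional
  have hconv : Convex ℝ (M '' stdSimplex ℝ ι) := (convex_stdSimplex ℝ ι).linear_image M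
  have hdisj : Disjoint (M '' stdSimplex ℝ ι) (Iic 0) := by
    rw [Set.disjoint_left]
    rintro _ ⟨w, hw, rfl⟩ hle
    obtain ⟨i, hi⟩ := hcon w hw
    have := hle i
    rw [hM w hw i] at this
    exact absurd hi (not_lt.mpr this)
  obtain ⟨f, a, b, hfa, hab, hfb⟩ :=
    geometric_hahn_banach_compact_closed hconv hcomp (convex_Iic 0) isClosed_Iic hdisj
  have hb : b < 0 := by simpa using hfb 0 (by simp)
  have hf : ∀ x : ι → ℝ, f x = ∑ i, x i * f (Pi.single i 1) := by
    intro x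
    conv_lhs => rw [pi_eq_sum_univ' x, map_sum]
    refine Finset.sum_congr rfl fun i _ => ?_
    rw [map_smul, smul_eq_mul]
  -- `f` is bounded below on the orthant, hence along each ray `-n eᵢ`.
  have hneg : ∀ i, f (Pi.single i 1) ≤ 0 := by
    intro i
    by_contra! hpos
    obtain ⟨n, hn⟩ := exists_nat_gt (-b / f (Pi.single i 1))
    have h1 := hfb (-(n : ℝ) • Pi.single i 1) (by
      intro j
      by_cases h : j = i
      · subst h; simp
      · simp [h])
    rw [map_smul, smul_eq_mul] at h1
    rw [div_lt_iff₀ hpos] at hn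
    linarith
  -- Normalised, the separating functional itself supplies the contradictory weights: monotonicity
  -- makes `f` nonnegative at their image, whereas separation forces `f < b < 0` there.
  set l : ι → ℝ := fun i => -f (Pi.single i 1) with hl
  have hl0 : ∀ i, 0 ≤ l i := fun i => by simpa [hl] using hneg i
  have hL0 : 0 ≤ ∑ i, l i := Finset.sum_nonneg fun i _ => hl0 i
  have hL : 0 < ∑ i, l i := by
    rcases hL0.lt_or_eq with h | h
    · exact h
    · exfalso
      have h0 : ∀ i, f (Pi.single i 1) = 0 := fun i => by
        have := (Finset.sum_eq_zero_iff_of_nonneg (fun i _ => hl0 i)).1 h.symm i (Finset.mem_univ i)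
        simpa [hl] using this
      obtain ⟨i⟩ := ‹Nonempty ι›
      have h1 := hfa _ ⟨Pi.single i 1, single_mem_stdSimplex ℝ i, rfl⟩
      rw [hf] at h1
      simp [h0] at h1
      linarith
  have hw : (fun i => l i / ∑ j, l j) ∈ stdSimplex ℝ ι :=
    ⟨fun i => div_nonneg (hl0 i) hL0, by rw [← Finset.sum_div, div_self hL.ne']⟩
  have h1 := hfa _ ⟨_, hw, rfl⟩
  rw [hf] at h1
  -- Symmetrising in `i, j` turns the summand into `-lᵢ lⱼ ⟪Tᵢ - Tⱼ, vᵢ - vⱼ⟫`.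
  have h2 : ∑ i, ∑ j, l i * l j * inner ℝ (T i) (v j - v i) ≤ 0 := by
    have hs : ∑ i, ∑ j, l i * l j * inner ℝ (T i) (v j - v i)
        = ∑ i, ∑ j, l i * l j * inner ℝ (T j) (v i - v j) := by
      rw [Finset.sum_comm]
      exact Finset.sum_congr rfl fun i _ => Finset.sum_congr rfl fun j _ => by ring
    have hd : ∑ i, ∑ j, l i * l j * inner ℝ (T i) (v j - v i)
        + ∑ i, ∑ j, l i * l j * inner ℝ (T j) (v i - v j) ≤ 0 := by
      rw [← Finset.sum_add_distrib]
      refine Finset.sum_nonpos fun i _ => ?_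
      rw [← Finset.sum_add_distrib]
      refine Finset.sum_nonpos fun j _ => ?_
      have h3 := mul_nonneg (mul_nonneg (hl0 i) (hl0 j)) (hmono i j)
      simp only [inner_sub_left, inner_sub_right] at h3 ⊢
      linarith
    linarith
  have h4 : ∑ i, M (fun i => l i / ∑ j, l j) i * f (Pi.single i 1)
      = -(∑ i, ∑ j, l i * l j * inner ℝ (T i) (v j - v i)) / ∑ j, l j := by
    rw [neg_div, Finset.sum_div, ← Finset.sum_neg_distrib]
    refine Finset.sum_congr rfl fun i _ => ?_
    change (∑ j, l j / (∑ j, l j) * inner ℝ (T i) (v j - v i)) * f (Pi.single i 1) = _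
    have : f (Pi.single i 1) = -l i := by simp [hl]
    rw [this, Finset.sum_mul, Finset.sum_div, ← Finset.sum_neg_distrib]
    exact Finset.sum_congr rfl fun j _ => by ring
  have h5 : 0 ≤ -(∑ i, ∑ j, l i * l j * inner ℝ (T i) (v j - v i)) / ∑ j, l j :=
    div_nonneg (by linarith) hL0
  linarith

variable [CompleteSpace V]

/-- Minty's variational inequality is solvable on closed balls. -/
theorem exists_minty_closedBall (T : V → V)
    (hmono : ∀ v w, 0 ≤ inner ℝ (T v - T w) (v - w)) {R : ℝ} (hR : 0 ≤ R) :
    ∃ u, ‖u‖ ≤ R ∧ ∀ v, ‖v‖ ≤ R → inner ℝ (T v) (u - v) ≤ 0 := by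
  -- Each Minty inequality cuts out a weak-* closed half-space; Banach-Alaoglu reduces to finitely
  -- many of them, and Riesz identifies the dual with `V`.
  have hK := WeakDual.isCompact_closedBall (𝕜 := ℝ) (E := V) 0 R
  have hne := hK.inter_iInter_nonempty
    (fun v : {v : V // ‖v‖ ≤ R} => {f : WeakDual ℝ V | f (T v) ≤ inner ℝ (T v) (v : V)})
    (fun v => isClosed_le (WeakDual.eval_continuous _) continuous_const) (by
      intro s
      rcases s.eq_empty_or_nonempty with rfl | hs
      · exact ⟨0, by simp [hR]⟩
      have : Nonempty s := hs.to_subtype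
      obtain ⟨w, hw, hw'⟩ := exists_mem_stdSimplex_minty (fun i : s => ((i : {v : V // ‖v‖ ≤ R}) : V))
        (fun i : s => T i) (fun i j => hmono _ _)
      set u : V := ∑ j, w j • ((j : {v : V // ‖v‖ ≤ R}) : V) with hu
      have hu_norm : ‖u‖ ≤ R := by
        have := (convex_closedBall (0 : V) R).sum_mem (t := Finset.univ) (w := w)
          (z := fun i : s => ((i : {v : V // ‖v‖ ≤ R}) : V)) (fun i _ => hw.1 i) hw.2
          (fun i _ => by simpa using i.1.2)
        simpa [hu] using this
      refine ⟨StrongDual.toWeakDual (InnerProductSpace.toDual ℝ V u), ?_, ?_⟩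
      · simpa using hu_norm
      · simp only [mem_iInter, mem_ofPred_eq]
        intro v hv
        have := hw' ⟨v, hv⟩
        rw [inner_sub_right] at this
        simp only [StrongDual.toWeakDual_apply, InnerProductSpace.toDual_apply_apply]
        rw [real_inner_comm]
        linarith)
  obtain ⟨f, hf, hf'⟩ := hne
  refine ⟨(InnerProductSpace.toDual ℝ V).symm (WeakDual.toStrongDual f), by simpa using hf, ?_⟩
  intro v hv
  simp only [mem_iInter, mem_ofPred_eq] at hf'
  have := hf' ⟨v, hv⟩
  rw [inner_sub_right, real_inner_comm, InnerProductSpace.toDual_symm_apply]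
  simpa using this

/-- The Browder-Minty theorem: a monotone, hemicontinuous operator that is coercive on a sphere
has a zero. -/
theorem exists_zero_of_monotone_hemicontinuous (T : V → V)
    (hmono : ∀ v w, 0 ≤ inner ℝ (T v - T w) (v - w))
    (hcont : ∀ u w z, Continuous fun t : ℝ => inner ℝ (T (u + t • w)) z)
    {R : ℝ} (hR : 0 < R) (hcoer : ∀ v, ‖v‖ = R → 0 < inner ℝ (T v) v) :
    ∃ u, T u = 0 := by
  obtain ⟨u, hu, hmin⟩ := exists_minty_closedBall T hmono hR.le
  -- Minty's trick: use `v = u + t (w - u)`, divide by `t > 0`, and let `t` tend to 0.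
  have key : ∀ w, ‖w‖ ≤ R → inner ℝ (T u) (u - w) ≤ 0 := by
    intro w hw
    have hlim : Filter.Tendsto (fun t : ℝ => inner ℝ (T (u + t • (w - u))) (u - w))
        (nhdsWithin 0 (Ioi 0)) (nhds (inner ℝ (T u) (u - w))) := by
      have := (hcont u (w - u) (u - w)).tendsto 0
      simp only [zero_smul, add_zero] at this
      exact this.mono_left nhdsWithin_le_nhds
    refine le_of_tendsto hlim ?_
    filter_upwards [Ioo_mem_nhdsGT (zero_lt_one' ℝ)] with t ht
    have hmem : u + t • (w - u) ∈ Metric.closedBall (0 : V) R :=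
      (convex_closedBall (0 : V) R).add_smul_sub_mem (by simpa using hu) (by simpa using hw)
        ⟨ht.1.le, ht.2.le⟩
    have h1 := hmin _ (by simpa using hmem)
    have h2 : u - (u + t • (w - u)) = t • (u - w) := by
      rw [sub_add_eq_sub_sub, sub_self, zero_sub, ← smul_neg, neg_sub]
    rw [h2, inner_smul_right] at h1
    exact nonpos_of_mul_nonpos_right h1 ht.1
  have hlt : ‖u‖ < R := by
    refine lt_of_le_of_ne hu fun h => ?_
    have h1 := key 0 (by simpa using hR.le)
    rw [sub_zero] at h1
    exact absurd (hcoer u h) (not_lt.mpr h1)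
  refine ⟨u, ?_⟩
  by_contra hne
  have hpos : 0 < ‖T u‖ := norm_pos_iff.mpr hne
  -- The longest step along `-T u` for which the triangle inequality keeps the point in the ball;
  -- `key` then gives `s ‖T u‖² ≤ 0`.
  set s : ℝ := (R - ‖u‖) / ‖T u‖ with hs
  have hs0 : 0 < s := div_pos (by linarith) hpos
  have h1 := key (u - s • T u) (by
    calc ‖u - s • T u‖ ≤ ‖u‖ + ‖s • T u‖ := norm_sub_le _ _
      _ = R := by
        rw [norm_smul, Real.norm_of_nonneg hs0.le, hs, div_mul_cancel₀ _ hpos.ne']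
        ring)
  rw [sub_sub_cancel, inner_smul_right, real_inner_self_eq_norm_sq] at h1
  have : 0 < s * ‖T u‖ ^ 2 := by positivity
  linarith

end BrowderMinty

/-! ### The scalar space `H¹₀(Ω)` and the Poincaré inequality. -/

section Sobolev

variable {Ω : Set Plane}

theorem gradient_add_of_differentiable {ψ χ : Plane → ℝ} (hψ : Differentiable ℝ ψ)
    (hχ : Differentiable ℝ χ) (x : Plane) :
    gradient (ψ + χ) x = gradient ψ x + gradient χ x := by
  simp [gradient, fderiv_add (hψ x) (hχ x)]

theorem gradient_const_smul (a : ℝ) {ψ : Plane → ℝ} (hψ : Differentiable ℝ ψ) (x : Plane) :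
    gradient (a • ψ) x = a • gradient ψ x := by
  simp [gradient, fderiv_const_smul (hψ x)]

theorem norm_gradient (ψ : Plane → ℝ) (x : Plane) : ‖gradient ψ x‖ = ‖fderiv ℝ ψ x‖ := by
  simp [gradient]

namespace IsTestFunction

variable {ψ χ : Plane → ℝ}

theorem differentiable (hψ : IsTestFunction Ω ψ) : Differentiable ℝ ψ :=
  hψ.smooth.differentiable (by simp)

theorem zero : IsTestFunction Ω 0 where
  smooth := contDiff_const
  compact_support := HasCompactSupport.zero
  support_subset := by simp [tsupport]

theorem add (hψ : IsTestFunction Ω ψ) (hχ : IsTestFunction Ω χ) : IsTestFunction Ω (ψ + χ) where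
  smooth := hψ.smooth.add hχ.smooth
  compact_support := hψ.compact_support.add hχ.compact_support
  support_subset := (tsupport_add ψ χ).trans (union_subset hψ.support_subset hχ.support_subset)

theorem const_smul (a : ℝ) (hψ : IsTestFunction Ω ψ) : IsTestFunction Ω (a • ψ) where
  smooth := hψ.smooth.const_smul a
  compact_support := hψ.compact_support.smul_left (f := fun _ => a)
  support_subset := (tsupport_smul_subset_right (fun _ => a) ψ).trans hψ.support_subset

theorem memLp (hψ : IsTestFunction Ω ψ) : MemLp ψ 2 (volume.restrict Ω) :=
  (hψ.smooth.continuous.memLp_of_hasCompactSupport hψ.compact_support).restrict Ω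

theorem memLp_gradient (hψ : IsTestFunction Ω ψ) :
    MemLp (gradient ψ) 2 (volume.restrict Ω) := by
  have hc : Continuous (gradient ψ) :=
    (InnerProductSpace.toDual ℝ Plane).symm.continuous.comp
      (hψ.smooth.continuous_fderiv (by simp))
  have hs : HasCompactSupport (gradient ψ) :=
    (hψ.compact_support.fderiv ℝ).comp_left (map_zero (InnerProductSpace.toDual ℝ Plane).symm)
  exact (hc.memLp_of_hasCompactSupport hs).restrict Ω

theorem memLp_gradient_apply (hψ : IsTestFunction Ω ψ) (i : Fin 2) :
    MemLp (fun x => gradient ψ x i) 2 (volume.restrict Ω) :=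
  hψ.memLp_gradient.eval_piLp i

/-- Pairing with `ψ eᵢ` in `L²` expresses `∫ Gᵢ ψ` as a continuous functional of `G`. -/
theorem memLp_smul_single (hψ : IsTestFunction Ω ψ) (i : Fin 2) :
    MemLp (fun x => ψ x • (EuclideanSpace.single i 1 : Plane)) 2 (volume.restrict Ω) := by
  refine MemLp.of_eval_piLp fun j => ?_
  by_cases h : j = i
  · subst h; simpa using hψ.memLp
  · simp [h]

end IsTestFunction

/-- Pairs `(ψ, ∇ψ)` for test functions `ψ`. -/
def testPairs (Ω : Set Plane) :
    Submodule ℝ (Lp ℝ 2 (volume.restrict Ω) × Lp Plane 2 (volume.restrict Ω)) where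
  carrier := {p | ∃ ψ, IsTestFunction Ω ψ ∧ p.1 =ᵐ[volume.restrict Ω] ψ ∧
    p.2 =ᵐ[volume.restrict Ω] gradient ψ}
  zero_mem' := by
    refine ⟨0, IsTestFunction.zero, Lp.coeFn_zero _ _ _, ?_⟩
    filter_upwards [Lp.coeFn_zero Plane 2 (volume.restrict Ω)] with x hx
    rw [Prod.snd_zero, hx]
    simpa using (gradient_const x (0 : ℝ)).symm
  add_mem' := by
    rintro p q ⟨ψ, hψ, hψ1, hψ2⟩ ⟨χ, hχ, hχ1, hχ2⟩
    refine ⟨ψ + χ, hψ.add hχ, ?_, ?_⟩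
    · filter_upwards [Lp.coeFn_add p.1 q.1, hψ1, hχ1] with x h1 h2 h3
      rw [Prod.fst_add, h1, Pi.add_apply, h2, h3, Pi.add_apply]
    · filter_upwards [Lp.coeFn_add p.2 q.2, hψ2, hχ2] with x h1 h2 h3
      rw [Prod.snd_add, h1, Pi.add_apply, h2, h3,
        gradient_add_of_differentiable hψ.differentiable hχ.differentiable]
  smul_mem' := by
    rintro a p ⟨ψ, hψ, hψ1, hψ2⟩
    refine ⟨a • ψ, hψ.const_smul a, ?_, ?_⟩
    · filter_upwards [Lp.coeFn_smul a p.1, hψ1] with x h1 h2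
      rw [Prod.smul_fst, h1, Pi.smul_apply, h2, Pi.smul_apply]
    · filter_upwards [Lp.coeFn_smul a p.2, hψ2] with x h1 h2
      rw [Prod.smul_snd, h1, Pi.smul_apply, h2, gradient_const_smul a hψ.differentiable]

/-- The functional `(u, G) ↦ ∫_Ω u ∂ᵢψ + ∫_Ω Gᵢ ψ`. -/
def weakGradientDefect {ψ : Plane → ℝ} (hψ : IsTestFunction Ω ψ) (i : Fin 2) :
    (Lp ℝ 2 (volume.restrict Ω) × Lp Plane 2 (volume.restrict Ω)) →L[ℝ] ℝ :=
  (innerSL ℝ ((hψ.memLp_gradient_apply i).toLp _)).coprod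
    (innerSL ℝ ((hψ.memLp_smul_single i).toLp _))

theorem weakGradientDefect_apply {ψ : Plane → ℝ} (hψ : IsTestFunction Ω ψ) (i : Fin 2)
    (p : Lp ℝ 2 (volume.restrict Ω) × Lp Plane 2 (volume.restrict Ω)) :
    weakGradientDefect hψ i p
      = (∫ x in Ω, p.1 x * gradient ψ x i) + ∫ x in Ω, p.2 x i * ψ x := by
  rw [weakGradientDefect, ContinuousLinearMap.coprod_apply, innerSL_apply_apply,
    innerSL_apply_apply, L2.inner_def, L2.inner_def]
  congr 1
  · refine integral_congr_ae ?_
    filter_upwards [(hψ.memLp_gradient_apply i).coeFn_toLp] with x hx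
    simp [hx]
  · refine integral_congr_ae ?_
    filter_upwards [(hψ.memLp_smul_single i).coeFn_toLp] with x hx
    rw [hx, inner_smul_left, EuclideanSpace.inner_single_left]
    simp [mul_comm]

/-- The space `H¹₀(Ω)` of pairs `(u, ∇u)`, as a subspace of `L² × (L²)²`. -/
def H10 (Ω : Set Plane) :
    Submodule ℝ (Lp ℝ 2 (volume.restrict Ω) × Lp Plane 2 (volume.restrict Ω)) :=
  -- Integration by parts would give the kernel conditions on the closure; imposing them makes
  -- membership match `IsH10` directly.
  (testPairs Ω).topologicalClosure ⊓
    ⨅ (ψ : {ψ // IsTestFunction Ω ψ}) (i : Fin 2), (weakGradientDefect ψ.2 i).ker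

theorem isClosed_H10 : IsClosed (H10 Ω).carrier := by
  change IsClosed ((H10 Ω : Submodule ℝ _) : Set (Lp ℝ 2 (volume.restrict Ω) × Lp Plane 2 (volume.restrict Ω)))
  simp only [H10, Submodule.coe_inf, Submodule.coe_iInf]
  exact (Submodule.isClosed_topologicalClosure _).inter
    (isClosed_iInter fun ψ => isClosed_iInter fun i => (weakGradientDefect ψ.2 i).isClosed_ker)

/-- The product carries the max distance, so being `δ`-close to a test pair is exactly the two
bounds in `IsH10.approx`. -/
theorem mem_H10 {p : Lp ℝ 2 (volume.restrict Ω) × Lp Plane 2 (volume.restrict Ω)} :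
    p ∈ H10 Ω ↔ IsH10 Ω p.1 p.2 := by
  have hcl : p ∈ (testPairs Ω).topologicalClosure ↔
      ∀ δ : ℝ≥0∞, 0 < δ → ∃ ψ : Plane → ℝ, IsTestFunction Ω ψ ∧
        eLpNorm (fun x => p.1 x - ψ x) 2 (volume.restrict Ω) < δ ∧
        eLpNorm (fun x => p.2 x - gradient ψ x) 2 (volume.restrict Ω) < δ := by
    rw [← SetLike.mem_coe, Submodule.topologicalClosure_coe, EMetric.mem_closure_iff]
    refine forall₂_congr fun δ hδ => ?_
    constructor
    · rintro ⟨q, ⟨ψ, hψ, h1, h2⟩, hq⟩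
      rw [Prod.edist_eq, max_lt_iff, Lp.edist_def, Lp.edist_def] at hq
      refine ⟨ψ, hψ, ?_, ?_⟩
      · refine lt_of_eq_of_lt (eLpNorm_congr_ae ?_) hq.1
        filter_upwards [h1] with x hx
        simp [hx]
      · refine lt_of_eq_of_lt (eLpNorm_congr_ae ?_) hq.2
        filter_upwards [h2] with x hx
        simp [hx]
    · rintro ⟨ψ, hψ, h1, h2⟩
      refine ⟨(hψ.memLp.toLp ψ, hψ.memLp_gradient.toLp _),
        ⟨ψ, hψ, hψ.memLp.coeFn_toLp, hψ.memLp_gradient.coeFn_toLp⟩, ?_⟩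
      rw [Prod.edist_eq, max_lt_iff, Lp.edist_def, Lp.edist_def]
      refine ⟨lt_of_eq_of_lt (eLpNorm_congr_ae ?_) h1, lt_of_eq_of_lt (eLpNorm_congr_ae ?_) h2⟩
      · filter_upwards [hψ.memLp.coeFn_toLp] with x hx
        simp [hx]
      · filter_upwards [hψ.memLp_gradient.coeFn_toLp] with x hx
        simp [hx]
  have hwg : p ∈ (⨅ (ψ : {ψ // IsTestFunction Ω ψ}) (i : Fin 2),
      (weakGradientDefect ψ.2 i).ker) ↔ HasWeakGradient Ω p.1 p.2 := by
    simp only [Submodule.mem_iInf, LinearMap.mem_ker, ContinuousLinearMap.coe_coe,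
      weakGradientDefect_apply, add_eq_zero_iff_eq_neg, Subtype.forall, HasWeakGradient]
  rw [H10, Submodule.mem_inf, hcl, hwg]
  exact ⟨fun h => ⟨⟨Lp.memLp _, Lp.memLp _, h.2⟩, h.1⟩, fun h => ⟨h.approx, h.weak_gradient⟩⟩

theorem IsH10.congr_ae {u u' : Plane → ℝ} {G G' : Plane → Plane} (h : IsH10 Ω u G)
    (hu : u =ᵐ[volume.restrict Ω] u') (hG : G =ᵐ[volume.restrict Ω] G') : IsH10 Ω u' G' where
  memLp := (memLp_congr_ae hu).1 h.memLp
  memLp_grad := (memLp_congr_ae hG).1 h.memLp_grad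
  weak_gradient := by
    intro ψ hψ i
    have h1 : ∫ x in Ω, u' x * gradient ψ x i = ∫ x in Ω, u x * gradient ψ x i :=
      integral_congr_ae (by filter_upwards [hu] with x hx; rw [hx])
    have h2 : ∫ x in Ω, G' x i * ψ x = ∫ x in Ω, G x i * ψ x :=
      integral_congr_ae (by filter_upwards [hG] with x hx; rw [hx])
    rw [h1, h2, h.weak_gradient ψ hψ i]
  approx := by
    intro δ hδ
    obtain ⟨ψ, hψ, h1, h2⟩ := h.approx δ hδ
    refine ⟨ψ, hψ, lt_of_eq_of_lt (eLpNorm_congr_ae ?_) h1, lt_of_eq_of_lt (eLpNorm_congr_ae ?_) h2⟩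
    · filter_upwards [hu] with x hx; rw [hx]
    · filter_upwards [hG] with x hx; rw [hx]

theorem IsTestFunction.eLpNorm_gradient_restrict {ψ : Plane → ℝ} (hψ : IsTestFunction Ω ψ)
    (p : ℝ≥0∞) :
    eLpNorm (gradient ψ) p (volume.restrict Ω) = eLpNorm (gradient ψ) p volume := by
  refine eLpNorm_restrict_eq_of_support_subset ?_
  refine Subset.trans (fun x hx => ?_)
    ((subset_tsupport _).trans ((tsupport_fderiv_subset ℝ).trans hψ.support_subset))
  rw [Function.mem_support, ← norm_ne_zero_iff, norm_gradient, norm_ne_zero_iff] at hx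
  exact hx

/-- The Poincaré inequality on `H¹₀(Ω)` for a bounded set `Ω`. -/
theorem exists_poincare (hΩ : Bornology.IsBounded Ω) :
    ∃ C : ℝ, 0 ≤ C ∧ ∀ p ∈ H10 Ω, ‖p.1‖ ≤ C * ‖p.2‖ := by
  have hfin : volume Ω < ⊤ := hΩ.measure_lt_top
  have : IsFiniteMeasure (volume.restrict Ω) := ⟨by simpa using hfin⟩
  set C₀ := eLpNormLESNormFDerivOneConst (volume : Measure Plane) 2
  set M : ℝ≥0∞ := volume Ω ^ (1 / 2 : ℝ)
  have hMtop : M ≠ ⊤ := (ENNReal.rpow_lt_top_of_nonneg (by norm_num) hfin.ne).ne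
  -- Gagliardo-Nirenberg-Sobolev in the plane bounds `‖ψ‖₂` by `‖∇ψ‖₁`, since 2 is conjugate to the
  -- dimension; Hölder passes to `‖∇ψ‖₂` at the cost of `|Ω|^(1/2)`.
  have htest : ∀ ψ, IsTestFunction Ω ψ → eLpNorm ψ 2 (volume.restrict Ω)
      ≤ (C₀ * M) * eLpNorm (gradient ψ) 2 (volume.restrict Ω) := by
    intro ψ hψ
    have hconj : NNReal.HolderConjugate (Module.finrank ℝ Plane) 2 := by
      rw [finrank_euclideanSpace_fin]
      exact ⟨by norm_num, by norm_num, by norm_num⟩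
    calc eLpNorm ψ 2 (volume.restrict Ω) ≤ eLpNorm ψ 2 volume := eLpNorm_restrict_le _ _ _ _
      _ ≤ C₀ * eLpNorm (fderiv ℝ ψ) 1 volume :=
        eLpNorm_le_eLpNorm_fderiv_one volume (hψ.smooth.of_le (by simp)) hψ.compact_support hconj
      _ = C₀ * eLpNorm (gradient ψ) 1 (volume.restrict Ω) := by
        rw [hψ.eLpNorm_gradient_restrict, eLpNorm_congr_norm_ae (f := gradient ψ)
          (g := fderiv ℝ ψ) (Filter.Eventually.of_forall (norm_gradient ψ))]
      _ ≤ C₀ * (eLpNorm (gradient ψ) 2 (volume.restrict Ω) * M) := by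
        have h := eLpNorm_le_eLpNorm_mul_rpow_measure_univ (p := 1) (q := 2)
          (μ := volume.restrict Ω) (f := gradient ψ) (by norm_num) hψ.memLp_gradient.1
        have hexp : 1 / ENNReal.toReal 1 - 1 / ENNReal.toReal 2 = (1 / 2 : ℝ) := by norm_num
        rw [hexp, Measure.restrict_apply_univ] at h
        exact mul_le_mul_right h _
      _ = (C₀ * M) * eLpNorm (gradient ψ) 2 (volume.restrict Ω) := by ring
  refine ⟨(C₀ * M).toReal, ENNReal.toReal_nonneg, fun p hp => ?_⟩
  have hcl : closure (testPairs Ω).carrier ⊆ {p | ‖p.1‖ ≤ (C₀ * M).toReal * ‖p.2‖} := by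
    refine closure_minimal ?_ (isClosed_le (by fun_prop) (by fun_prop))
    rintro q ⟨ψ, hψ, h1, h2⟩
    have h := htest ψ hψ
    rw [← eLpNorm_congr_ae h1, ← eLpNorm_congr_ae h2] at h
    have h' := ENNReal.toReal_mono
      (ENNReal.mul_ne_top (ENNReal.mul_ne_top ENNReal.coe_ne_top hMtop) (Lp.eLpNorm_ne_top q.2)) h
    rwa [ENNReal.toReal_mul] at h'
  exact hcl hp.1

end Sobolev

/-! ### The abstract variational problem: existence and stability. -/

section AbstractProblem

variable {V H X : Type*} [NormedAddCommGroup V] [InnerProductSpace ℝ V]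
  [NormedAddCommGroup H] [InnerProductSpace ℝ H]
  [NormedAddCommGroup X] [InnerProductSpace ℝ X]
  {ι : V →L[ℝ] H} {P : V →L[ℝ] X} {C : ℝ}

/-- Solvability of `⟪P u, P w⟫ + ⟪ι w, N (ι u)⟫ = ⟪ι w, ε⟫` for a bounded, monotone and
hemicontinuous operator `N`. -/
theorem exists_variational_solution [CompleteSpace V] [CompleteSpace H] [CompleteSpace X]
    (hP : ∀ v, ‖v‖ ≤ C * ‖P v‖) {N : H → H}
    (hmono : ∀ y z, 0 ≤ inner ℝ (N y - N z) (y - z))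
    (hcont : ∀ y w z, Continuous fun t : ℝ => inner ℝ (N (y + t • w)) z)
    {M : ℝ} (hM : ∀ y, ‖N y‖ ≤ M) (ε : H) :
    ∃ u, ∀ w, inner ℝ (P u) (P w) + inner ℝ (ι w) (N (ι u)) = inner ℝ (ι w) ε := by
  set T : V → V := fun u => P.adjoint (P u) + ι.adjoint (N (ι u) - ε) with hT
  have hTin : ∀ u w, inner ℝ (T u) w = inner ℝ (P u) (P w) + inner ℝ (N (ι u) - ε) (ι w) := by
    intro u w
    rw [hT, inner_add_left, ContinuousLinearMap.adjoint_inner_left,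
      ContinuousLinearMap.adjoint_inner_left]
  have hM0 : 0 ≤ M := (norm_nonneg _).trans (hM 0)
  set A : ℝ := (M + ‖ε‖) * ‖ι‖ with hA
  have hA0 : 0 ≤ A := by positivity
  -- On the sphere of radius `R` the lower-order term is at most `A R`, while `C² ‖P v‖² ≥ R² = C² A
  -- R + R`, so the quadratic term wins.
  set R : ℝ := A * C ^ 2 + 1 with hR
  have hR0 : 0 < R := by positivity
  obtain ⟨u, hu⟩ := exists_zero_of_monotone_hemicontinuous T
    (fun v w => by
      rw [inner_sub_left, hTin, hTin]
      have h1 := hmono (ι v) (ι w)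
      have h2 : 0 ≤ inner ℝ (P (v - w)) (P (v - w)) := real_inner_self_nonneg
      simp only [map_sub, inner_sub_left, inner_sub_right] at h1 h2 ⊢
      linarith)
    (fun u w z => by
      simp only [hTin, map_add, map_smul, inner_add_left, inner_sub_left, inner_smul_left]
      simp only [conj_trivial]
      exact (continuous_const.add (continuous_id.mul continuous_const)).add
        ((hcont (ι u) (ι w) (ι z)).sub continuous_const))
    hR0
    (fun v hv => by
      rw [hTin, real_inner_self_eq_norm_sq]
      have h1 : |inner ℝ (N (ι v) - ε) (ι v)| ≤ A * R := by
        calc |inner ℝ (N (ι v) - ε) (ι v)| ≤ ‖N (ι v) - ε‖ * ‖ι v‖ := abs_real_inner_le_norm _ _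
          _ ≤ (M + ‖ε‖) * (‖ι‖ * ‖v‖) :=
            mul_le_mul ((norm_sub_le _ _).trans (add_le_add_left (hM _) _)) (ι.le_opNorm v)
              (norm_nonneg _) (by positivity)
          _ = A * R := by rw [hv, hA]; ring
      have h2 : R ^ 2 ≤ C ^ 2 * ‖P v‖ ^ 2 := by
        rw [← mul_pow]
        exact pow_le_pow_left₀ hR0.le (hv ▸ hP v) 2
      have h3 : C ^ 2 * (A * R) < R ^ 2 := by
        have : R ^ 2 = C ^ 2 * (A * R) + R := by rw [hR]; ring
        linarith
      have h4 : A * R < ‖P v‖ ^ 2 := lt_of_mul_lt_mul_left (h3.trans_le h2) (sq_nonneg C)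
      linarith [neg_abs_le (inner ℝ (N (ι v) - ε) (ι v))])
  refine ⟨u, fun w => ?_⟩
  have h := hTin u w
  rw [hu, inner_zero_left, inner_sub_left, real_inner_comm _ (N (ι u)), real_inner_comm _ ε] at h
  linarith

/-- Stability of solutions under perturbation of the nonlinearity. -/
theorem norm_sub_variational_solution_le
    (hP : ∀ v, ‖v‖ ≤ C * ‖P v‖) {N₁ N₂ : H → H}
    (hmono : ∀ y z, 0 ≤ inner ℝ (N₁ y - N₁ z) (y - z)) {ε : H} {u₁ u₂ : V}
    (h₁ : ∀ w, inner ℝ (P u₁) (P w) + inner ℝ (ι w) (N₁ (ι u₁)) = inner ℝ (ι w) ε)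
    (h₂ : ∀ w, inner ℝ (P u₂) (P w) + inner ℝ (ι w) (N₂ (ι u₂)) = inner ℝ (ι w) ε) :
    ‖u₁ - u₂‖ ≤ C ^ 2 * ‖ι‖ * ‖N₁ (ι u₂) - N₂ (ι u₂)‖ := by
  set w := u₁ - u₂ with hw
  set D := N₁ (ι u₂) - N₂ (ι u₂) with hD
  -- Split `N₁ (ι u₁) - N₂ (ι u₂)` as `(N₁ (ι u₁) - N₁ (ι u₂)) + D`; the first part has a favourable
  -- sign by monotonicity.
  have h3 : ‖P w‖ ^ 2 ≤ -inner ℝ (ι w) D := by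
    have e1 := h₁ w
    have e2 := h₂ w
    have e3 := hmono (ι u₁) (ι u₂)
    rw [← real_inner_self_eq_norm_sq, real_inner_comm (ι u₁ - ι u₂), ← map_sub, ← hw] at *
    have e4 : inner ℝ (P w) (P w) = inner ℝ (P u₁) (P w) - inner ℝ (P u₂) (P w) := by
      rw [← inner_sub_left, ← map_sub]
    rw [inner_sub_right] at e3
    rw [e4, hD, inner_sub_right]
    linarith
  have h4 : -inner ℝ (ι w) D ≤ ‖ι‖ * ‖w‖ * ‖D‖ :=
    (neg_le_abs _).trans ((abs_real_inner_le_norm _ _).trans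
      (mul_le_mul_of_nonneg_right (ι.le_opNorm w) (norm_nonneg _)))
  have h5 : ‖w‖ ^ 2 ≤ C ^ 2 * ‖P w‖ ^ 2 := by
    rw [← mul_pow]
    exact pow_le_pow_left₀ (norm_nonneg _) (hP w) 2
  have h6 : ‖w‖ * ‖w‖ ≤ ‖w‖ * (C ^ 2 * ‖ι‖ * ‖D‖) := by
    have := mul_le_mul_of_nonneg_left (h3.trans h4) (sq_nonneg C)
    nlinarith
  rcases (norm_nonneg w).eq_or_lt with h | h
  · rw [← h]; positivity
  · exact le_of_mul_le_mul_left h6 h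

end AbstractProblem

/-! ### The Hilbert space `H¹₀(Ω)²`. -/

section VectorSobolev

variable {Ω : Set Plane}

/-- The component map `y ↦ yᵢ` on `L²(Ω)²`. -/
def component (Ω : Set Plane) (i : Fin 2) : VecL2 Ω →L[ℝ] Lp ℝ 2 (volume.restrict Ω) :=
  (EuclideanSpace.proj i : Plane →L[ℝ] ℝ).compLpL 2 (volume.restrict Ω)

theorem coeFn_component (i : Fin 2) (y : VecL2 Ω) :
    component Ω i y =ᵐ[volume.restrict Ω] fun x => y x i :=
  (EuclideanSpace.proj i : Plane →L[ℝ] ℝ).coeFn_compLpL y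

theorem norm_sq_eq_sum_component (y : VecL2 Ω) : ‖y‖ ^ 2 = ∑ i, ‖component Ω i y‖ ^ 2 := by
  simp only [← real_inner_self_eq_norm_sq, L2.inner_def]
  rw [← integral_finsetSum _ fun i _ => L2.integrable_inner _ _]
  refine integral_congr_ae ?_
  filter_upwards [ae_all_iff.2 fun i => coeFn_component i y] with x hx
  simp only [PiLp.inner_apply, hx]

/-- A function in `L²(Ω)²` (index `none`) with the two rows of a Jacobian (index `some i`). -/
abbrev Jet (Ω : Set Plane) : Type := PiLp 2 fun _ : Option (Fin 2) => VecL2 Ω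

/-- The `i`-th component of a jet, with its gradient. -/
def jetComponent (Ω : Set Plane) (i : Fin 2) :
    Jet Ω →L[ℝ] Lp ℝ 2 (volume.restrict Ω) × Lp Plane 2 (volume.restrict Ω) :=
  ((component Ω i).comp (PiLp.proj 2 _ none)).prod (PiLp.proj 2 _ (some i))

/-- The Hilbert space `H¹₀(Ω)²`, as a subspace of the space of jets. -/
def VecH10 (Ω : Set Plane) : Submodule ℝ (Jet Ω) :=
  ⨅ i, (H10 Ω).comap (jetComponent Ω i).toLinearMap

theorem isClosed_VecH10 : IsClosed (VecH10 Ω : Set (Jet Ω)) := by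
  simp only [VecH10, Submodule.coe_iInf]
  exact isClosed_iInter fun i => isClosed_H10.preimage (jetComponent Ω i).continuous

instance : CompleteSpace (VecH10 Ω) := isClosed_VecH10.completeSpace_coe

theorem mem_VecH10 {v : Jet Ω} :
    v ∈ VecH10 Ω ↔ IsVecH10 Ω (v none) (fun i => v (some i)) := by
  simp only [VecH10, Submodule.mem_iInf, Submodule.mem_comap, IsVecH10]
  refine forall_congr' fun i => ?_
  change jetComponent Ω i v ∈ H10 Ω ↔ _
  rw [mem_H10]
  exact ⟨fun h => h.congr_ae (coeFn_component i _) .rfl,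
    fun h => h.congr_ae (coeFn_component i _).symm .rfl⟩

theorem IsVecH10.exists_jet {v : Plane → Plane} {Dv : Fin 2 → Plane → Plane}
    (h : IsVecH10 Ω v Dv) : ∃ w ∈ VecH10 Ω, w none =ᵐ[volume.restrict Ω] v ∧
      ∀ i, w (some i) =ᵐ[volume.restrict Ω] Dv i := by
  have hv : MemLp v 2 (volume.restrict Ω) := MemLp.of_eval_piLp fun i => (h i).memLp
  refine ⟨WithLp.toLp 2 fun o => o.elim (hv.toLp v) fun i => (h i).memLp_grad.toLp _, ?_,
    hv.coeFn_toLp, fun i => (h i).memLp_grad.coeFn_toLp⟩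
  rw [mem_VecH10]
  intro i
  refine (h i).congr_ae ?_ (h i).memLp_grad.coeFn_toLp.symm
  filter_upwards [hv.coeFn_toLp] with x hx
  simp [hx]

/-- The embedding of `H¹₀(Ω)²` into `L²(Ω)²`. -/
def embed (Ω : Set Plane) : VecH10 Ω →L[ℝ] VecL2 Ω :=
  (PiLp.proj 2 (fun _ : Option (Fin 2) => VecL2 Ω) none).comp (VecH10 Ω).subtypeL

/-- The Jacobian on `H¹₀(Ω)²`. -/
def jacobian (Ω : Set Plane) : VecH10 Ω →L[ℝ] PiLp 2 fun _ : Fin 2 => VecL2 Ω :=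
  ((PiLp.continuousLinearEquiv 2 ℝ fun _ : Fin 2 => VecL2 Ω).symm.toContinuousLinearMap.comp
    (ContinuousLinearMap.pi fun i => PiLp.proj 2 _ (some i))).comp (VecH10 Ω).subtypeL

theorem embed_apply (v : VecH10 Ω) : embed Ω v = v.1 none := rfl

/-- The squared jet norm is the `L²` part plus the gradient part, and Poincaré applied to each
component controls the former. -/
theorem exists_norm_le_jacobian (hΩ : Bornology.IsBounded Ω) :
    ∃ C : ℝ, ∀ v : VecH10 Ω, ‖v‖ ≤ C * ‖jacobian Ω v‖ := by
  obtain ⟨C, hC, hP⟩ := exists_poincare hΩ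
  refine ⟨√(C ^ 2 + 1), fun v => ?_⟩
  refine abs_le_of_sq_le_sq' ?_ (by positivity) |>.2
  rw [mul_pow, Real.sq_sqrt (by positivity)]
  have h1 : ‖v‖ ^ 2 = ‖v.1 none‖ ^ 2 + ∑ i, ‖v.1 (some i)‖ ^ 2 := by
    change ‖v.1‖ ^ 2 = _
    rw [PiLp.norm_sq_eq_of_L2, Fintype.sum_option]
  have h2 : ‖jacobian Ω v‖ ^ 2 = ∑ i, ‖v.1 (some i)‖ ^ 2 := by
    rw [PiLp.norm_sq_eq_of_L2]; rfl
  have h3 : ‖v.1 none‖ ^ 2 ≤ C ^ 2 * ∑ i, ‖v.1 (some i)‖ ^ 2 := by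
    rw [norm_sq_eq_sum_component, Finset.mul_sum]
    refine Finset.sum_le_sum fun i _ => ?_
    rw [← mul_pow]
    exact pow_le_pow_left₀ (norm_nonneg _) (hP _ ((Submodule.mem_iInf _).1 v.2 i)) 2
  rw [h1, h2]
  linarith

end VectorSobolev

/-! ### Superposition operators and weak solutions. -/

section Nemytskii

variable {Ω : Set Plane}

/-- Continuous monotone nonlinearities bounded by `M`. -/
structure IsBoundedMonotone (g : Plane → Plane) (M : ℝ) : Prop where
  continuous : Continuous g
  norm_le : ∀ y, ‖g y‖ ≤ M
  monotone : ∀ y z, 0 ≤ inner ℝ (g y - g z) (y - z)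

variable {g : Plane → Plane} {M : ℝ} [IsFiniteMeasure (volume.restrict Ω)]

theorem IsBoundedMonotone.memLp_comp (hg : IsBoundedMonotone g M) (y : VecL2 Ω) :
    MemLp (fun x => g (y x)) 2 (volume.restrict Ω) :=
  MemLp.of_bound (hg.continuous.comp_aestronglyMeasurable (Lp.aestronglyMeasurable y)) M
    (Filter.Eventually.of_forall fun _ => hg.norm_le _)

/-- The superposition operator `y ↦ g ∘ y` on `L²(Ω)²`. -/
def nemytskii (hg : IsBoundedMonotone g M) (y : VecL2 Ω) : VecL2 Ω :=
  (hg.memLp_comp y).toLp _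

theorem coeFn_nemytskii (hg : IsBoundedMonotone g M) (y : VecL2 Ω) :
    nemytskii hg y =ᵐ[volume.restrict Ω] fun x => g (y x) :=
  (hg.memLp_comp y).coeFn_toLp

theorem inner_nemytskii (hg : IsBoundedMonotone g M) (y z : VecL2 Ω) :
    inner ℝ z (nemytskii hg y) = ∫ x in Ω, inner ℝ (z x) (g (y x)) := by
  rw [L2.inner_def]
  refine integral_congr_ae ?_
  filter_upwards [coeFn_nemytskii hg y] with x hx
  rw [hx]

theorem nemytskii_monotone (hg : IsBoundedMonotone g M) (y z : VecL2 Ω) :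
    0 ≤ inner ℝ (nemytskii hg y - nemytskii hg z) (y - z) := by
  rw [L2.inner_def]
  refine integral_nonneg_of_ae ?_
  filter_upwards [coeFn_nemytskii hg y, coeFn_nemytskii hg z, Lp.coeFn_sub y z,
    Lp.coeFn_sub (nemytskii hg y) (nemytskii hg z)] with x h1 h2 h3 h4
  rw [h4, h3, Pi.sub_apply, Pi.sub_apply, h1, h2]
  exact hg.monotone _ _

theorem norm_nemytskii_le (hg : IsBoundedMonotone g M) (y : VecL2 Ω) :
    ‖nemytskii hg y‖ ≤ (volume.restrict Ω).real univ ^ (2 : ℝ≥0∞).toReal⁻¹ * M := by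
  refine Lp.norm_le_of_ae_bound ((norm_nonneg _).trans (hg.norm_le 0)) ?_
  filter_upwards [coeFn_nemytskii hg y] with x hx
  rw [hx]
  exact hg.norm_le _

/-- Hemicontinuity by dominated convergence: `M ‖z‖` is integrable because `Ω` has finite measure.
-/
theorem continuous_inner_nemytskii (hg : IsBoundedMonotone g M) (y w z : VecL2 Ω) :
    Continuous fun t : ℝ => inner ℝ (nemytskii hg (y + t • w)) z := by
  have h : ∀ t : ℝ, inner ℝ (nemytskii hg (y + t • w)) z
      = ∫ x in Ω, inner ℝ (g (y x + t • w x)) (z x) := by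
    intro t
    rw [real_inner_comm, inner_nemytskii]
    refine integral_congr_ae ?_
    filter_upwards [Lp.coeFn_add y (t • w), Lp.coeFn_smul t w] with x h1 h2
    rw [h1, Pi.add_apply, h2, Pi.smul_apply, real_inner_comm]
  simp only [h]
  have hz : Integrable z (volume.restrict Ω) := (Lp.memLp z).integrable (by norm_num)
  refine continuous_of_dominated (bound := fun x => M * ‖z x‖) (fun t => ?_) (fun t => ?_)
    (hz.norm.const_mul M) ?_
  · exact (hg.continuous.comp_aestronglyMeasurable
      ((Lp.aestronglyMeasurable y).add ((Lp.aestronglyMeasurable w).const_smul t))).inner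
      (Lp.aestronglyMeasurable z)
  · refine Filter.Eventually.of_forall fun x => (norm_inner_le_norm _ _).trans ?_
    exact mul_le_mul_of_nonneg_right (hg.norm_le _) (norm_nonneg _)
  · refine Filter.Eventually.of_forall fun x => ?_
    have := hg.continuous
    fun_prop

/-- Bridge to the abstract problem: pointwise representatives of states and test functions are
exchanged for elements of `VecH10 Ω`, which leaves the integrals unchanged. -/
theorem isWeakSolution_iff (hg : IsBoundedMonotone g M) {ε y : VecL2 Ω} :
    IsWeakSolution Ω g ε y ↔ ∃ u : VecH10 Ω, embed Ω u = y ∧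
      ∀ w, inner ℝ (jacobian Ω u) (jacobian Ω w) + inner ℝ (embed Ω w) (nemytskii hg (embed Ω u))
        = inner ℝ (embed Ω w) ε := by
  have hjac : ∀ u w : VecH10 Ω, inner ℝ (jacobian Ω u) (jacobian Ω w)
      = ∫ x in Ω, ∑ i : Fin 2, inner ℝ (u.1 (some i) x) (w.1 (some i) x) := by
    intro u w
    rw [integral_finsetSum _ fun i _ => L2.integrable_inner _ _, PiLp.inner_apply]
    rfl
  constructor
  · rintro ⟨Dy, hy, hsol⟩
    obtain ⟨u, hu, hu0, hui⟩ := hy.exists_jet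
    have huy : u none = y := Lp.ext hu0
    refine ⟨⟨u, hu⟩, huy, fun w => ?_⟩
    have h := hsol _ _ (mem_VecH10.1 w.2)
    rw [hjac, inner_nemytskii, embed_apply, embed_apply, L2.inner_def, ← h]
    simp only [huy]
    congr 1
    refine integral_congr_ae ?_
    filter_upwards [ae_all_iff.2 hui] with x hx
    simp only [hx]
  · rintro ⟨u, rfl, hsol⟩
    refine ⟨_, mem_VecH10.1 u.2, fun v Dv hv => ?_⟩
    obtain ⟨w, hw, hw0, hwi⟩ := hv.exists_jet
    have h := hsol ⟨w, hw⟩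
    rw [hjac, inner_nemytskii, embed_apply, embed_apply, L2.inner_def] at h
    rw [embed_apply]
    convert h using 1
    · congr 1
      · refine integral_congr_ae ?_
        filter_upwards [ae_all_iff.2 hwi] with x hx
        simp only [hx]
        rfl
      · refine integral_congr_ae ?_
        filter_upwards [hw0] with x hx
        rw [hx]
    · refine integral_congr_ae ?_
      filter_upwards [hw0] with x hx
      rw [hx]

theorem existsUnique_isWeakSolution (hΩ : Bornology.IsBounded Ω) (hg : IsBoundedMonotone g M)
    (ε : VecL2 Ω) : ∃! y, IsWeakSolution Ω g ε y := by
  obtain ⟨C, hC⟩ := exists_norm_le_jacobian hΩ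
  obtain ⟨u, hu⟩ := exists_variational_solution (ι := embed Ω) hC (nemytskii_monotone hg)
    (continuous_inner_nemytskii hg) (norm_nemytskii_le hg) ε
  refine ⟨embed Ω u, (isWeakSolution_iff hg).2 ⟨u, rfl, hu⟩, fun y hy => ?_⟩
  obtain ⟨u', rfl, hu'⟩ := (isWeakSolution_iff hg).1 hy
  have h := norm_sub_variational_solution_le hC (nemytskii_monotone hg) hu' hu
  rw [sub_self, norm_zero, mul_zero] at h
  rw [sub_eq_zero.1 (norm_le_zero_iff.1 h)]

end Nemytskii

/-! ### Dependence of the state on the coefficients. -/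

section Fitting

variable {Ω : Set Plane} {K : ℕ} {φ : Fin K → Plane → Plane} {αmax : ℝ}

theorem BasisAssumption.exists_isBoundedMonotone (hφ : BasisAssumption φ) (j : Fin K) :
    ∃ M, IsBoundedMonotone (φ j) M := by
  obtain ⟨c, C, hc, hb⟩ := hφ.bounded j
  refine ⟨‖C‖, (hφ.contDiff j).continuous, fun y => ?_, hφ.monotone j⟩
  rw [EuclideanSpace.norm_eq, EuclideanSpace.norm_eq]
  refine Real.sqrt_le_sqrt (Finset.sum_le_sum fun i _ => ?_)
  have h0 : 0 ≤ φ j y i := (hc i).1.le.trans (hb y i).1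
  rw [Real.norm_of_nonneg h0, Real.norm_of_nonneg (h0.trans (hb y i).2)]
  exact pow_le_pow_left₀ h0 (hb y i).2 2

theorem isBoundedMonotone_nonlinearity {M : Fin K → ℝ} (hM : ∀ j, IsBoundedMonotone (φ j) (M j))
    {α : Fin K → ℝ} (hα : ∀ j, 0 ≤ α j) :
    IsBoundedMonotone (nonlinearity φ α) (∑ j, α j * M j) where
  continuous := continuous_finsetSum _ fun j _ => (hM j).continuous.const_smul (α j)
  norm_le y := by
    refine (norm_sum_le _ _).trans (Finset.sum_le_sum fun j _ => ?_)
    rw [norm_smul, Real.norm_of_nonneg (hα j)]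
    exact mul_le_mul_of_nonneg_left ((hM j).norm_le y) (hα j)
  monotone y z := by
    simp only [nonlinearity, ← Finset.sum_sub_distrib, ← smul_sub, sum_inner, inner_smul_left]
    exact Finset.sum_nonneg fun j _ => mul_nonneg (hα j) ((hM j).monotone y z)

theorem isCompact_coeffsUpTo (K : ℕ) (αmax : ℝ) (k : ℕ) : IsCompact (coeffsUpTo K αmax k) := by
  have hc : IsCompact (Set.pi univ fun _ : Fin K => Icc 0 αmax) :=
    isCompact_univ_pi fun _ => isCompact_Icc
  refine hc.of_isClosed_subset ?_ fun α hα j _ => hα.1 j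
  have : coeffsUpTo K αmax k = (⋂ j, {α : Fin K → ℝ | 0 ≤ α j ∧ α j ≤ αmax}) ∩
      ⋂ j : Fin K, ⋂ _ : k ≤ (j : ℕ), {α : Fin K → ℝ | α j = 0} := by
    ext α
    simp [coeffsUpTo, coeffs]
  rw [this]
  refine (isClosed_iInter fun j => ?_).inter
    (isClosed_iInter fun j => isClosed_iInter fun _ => ?_)
  · exact (isClosed_le continuous_const (continuous_apply j)).inter
      (isClosed_le (continuous_apply j) continuous_const)
  · exact isClosed_eq (continuous_apply j) continuous_const

/-- The state depends Lipschitz continuously on the coefficients of the nonlinearity. -/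
theorem exists_lipschitz_state (hΩ : Bornology.IsBounded Ω) {M : Fin K → ℝ}
    (hM : ∀ j, IsBoundedMonotone (φ j) (M j)) :
    ∃ L : ℝ, 0 ≤ L ∧ ∀ (ε y₁ y₂ : VecL2 Ω) (α β : Fin K → ℝ), (∀ j, 0 ≤ α j) → (∀ j, 0 ≤ β j) →
      IsWeakSolution Ω (nonlinearity φ α) ε y₁ → IsWeakSolution Ω (nonlinearity φ β) ε y₂ →
      ‖y₁ - y₂‖ ≤ L * ‖α - β‖ := by
  have : IsFiniteMeasure (volume.restrict Ω) := ⟨by simpa using hΩ.measure_lt_top⟩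
  obtain ⟨C, hC⟩ := exists_norm_le_jacobian hΩ
  have hM0 : ∀ j, 0 ≤ M j := fun j => (norm_nonneg _).trans ((hM j).norm_le 0)
  set m : ℝ := (volume.restrict Ω).real univ ^ (2 : ℝ≥0∞).toReal⁻¹
  have hm0 : 0 ≤ m := by positivity
  have hS : 0 ≤ ∑ j, M j := Finset.sum_nonneg fun j _ => hM0 j
  refine ⟨‖embed Ω‖ * (C ^ 2 * ‖embed Ω‖ * (m * ∑ j, M j)), by positivity, ?_⟩
  intro ε y₁ y₂ α β hα hβ h₁ h₂
  have gα := isBoundedMonotone_nonlinearity hM hα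
  have gβ := isBoundedMonotone_nonlinearity hM hβ
  obtain ⟨u₁, rfl, hu₁⟩ := (isWeakSolution_iff gα).1 h₁
  obtain ⟨u₂, rfl, hu₂⟩ := (isWeakSolution_iff gβ).1 h₂
  have hstab := norm_sub_variational_solution_le hC (nemytskii_monotone gα) hu₁ hu₂
  -- Pointwise, the difference is at most `∑ⱼ |αⱼ - βⱼ| Mⱼ`, uniformly in the state; `‖α - β‖` is
  -- the sup norm.
  have hN : ‖nemytskii gα (embed Ω u₂) - nemytskii gβ (embed Ω u₂)‖
      ≤ m * ((∑ j, M j) * ‖α - β‖) := by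
    refine Lp.norm_le_of_ae_bound (by positivity) ?_
    filter_upwards [coeFn_nemytskii gα (embed Ω u₂), coeFn_nemytskii gβ (embed Ω u₂),
      Lp.coeFn_sub (nemytskii gα (embed Ω u₂)) (nemytskii gβ (embed Ω u₂))] with x h1 h2 h3
    rw [h3, Pi.sub_apply, h1, h2]
    simp only [nonlinearity, ← Finset.sum_sub_distrib, ← sub_smul]
    rw [Finset.sum_mul]
    refine (norm_sum_le _ _).trans (Finset.sum_le_sum fun j _ => ?_)
    rw [norm_smul, mul_comm]
    exact mul_le_mul ((hM j).norm_le _) (norm_le_pi_norm (α - β) j) (norm_nonneg _) (hM0 j)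
  calc ‖embed Ω u₁ - embed Ω u₂‖ ≤ ‖embed Ω‖ * ‖u₁ - u₂‖ := by
        rw [← map_sub]; exact (embed Ω).le_opNorm _
    _ ≤ ‖embed Ω‖ * (C ^ 2 * ‖embed Ω‖ * (m * ((∑ j, M j) * ‖α - β‖))) := by
        gcongr
        exact hstab.trans (by gcongr)
    _ = _ := by ring

end Fitting

end SemilinearFitting

end

/-! ### Existence for the fitting step. -/

open SemilinearFitting in
theorem mainTheorem5
    (Ω : Set Plane) (hΩ_open : IsOpen Ω) (hΩ_ne : Ω.Nonempty) (hΩ_conv : Convex ℝ Ω)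
    (hΩ_bdd : Bornology.IsBounded Ω)
    (εa εb : Plane) (hε : ∀ i, εa i ≤ εb i)
    (K : ℕ) (φ : Fin K → Plane → Plane) (hφ : BasisAssumption φ)
    (αmax : ℝ) (hαmax : 0 ≤ αmax)
    (hg : ∀ α ∈ coeffs K αmax, NonlinearityAssumption (nonlinearity φ α))
    (k : ℕ) (hk : 1 ≤ k) (hkK : k < K)
    (ε : Fin k → VecL2 Ω) (hε_adm : ∀ m, ε m ∈ admissibleControls Ω εa εb)
    (c : ℝ) :
    -- the states `y^{β,εᵐ}` are well defined
    (∀ β ∈ coeffsUpTo K αmax k, ∀ m,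
      ∃! y : VecL2 Ω, IsWeakSolution Ω (nonlinearity φ β) (ε m) y) ∧
    -- the target states are well defined
    (∀ m, ∃! z : VecL2 Ω, IsWeakSolution Ω (φ ⟨k, hkK⟩) (c • ε m) z) ∧
    -- for these target states, the fitting-step problem has a solution
    (∀ z : Fin k → VecL2 Ω,
      (∀ m, IsWeakSolution Ω (φ ⟨k, hkK⟩) (c • ε m) (z m)) →
      ∃ β' ∈ coeffsUpTo K αmax k, ∃ y' : Fin k → VecL2 Ω,
        FittingFeasible Ω φ αmax ε β' y' ∧
        ∀ (β : Fin K → ℝ) (y : Fin k → VecL2 Ω), FittingFeasible Ω φ αmax ε β y →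
          fittingCost z y' ≤ fittingCost z y) := by
  have : IsFiniteMeasure (volume.restrict Ω) := ⟨by simpa using hΩ_bdd.measure_lt_top⟩
  choose M hM using hφ.exists_isBoundedMonotone
  have hstate : ∀ β ∈ coeffsUpTo K αmax k, ∀ m,
      ∃! y : VecL2 Ω, IsWeakSolution Ω (nonlinearity φ β) (ε m) y := fun β hβ m =>
    existsUnique_isWeakSolution hΩ_bdd
      (isBoundedMonotone_nonlinearity hM fun j => (hβ.1 j).1) _
  refine ⟨hstate, fun m => existsUnique_isWeakSolution hΩ_bdd (hM _) _, fun z _ => ?_⟩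
  have hex : ∀ β : coeffsUpTo K αmax k, ∃ y : Fin k → VecL2 Ω,
      ∀ m, IsWeakSolution Ω (nonlinearity φ β) (ε m) (y m) := fun β => by
    choose y hy using fun m => (hstate β β.2 m).exists
    exact ⟨y, hy⟩
  choose S hS using hex
  obtain ⟨L, hL, hLip⟩ := exists_lipschitz_state hΩ_bdd hM
  have hcont : ∀ m, Continuous fun β => S β m := fun m =>
    (LipschitzWith.of_dist_le_mul (K := ⟨L, hL⟩) fun α β => by
      rw [Subtype.dist_eq, dist_eq_norm, dist_eq_norm]
      exact hLip _ _ _ _ _ (fun j => (α.2.1 j).1) (fun j => (β.2.1 j).1) (hS α m) (hS β m)).continuous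
  have hcost : Continuous fun β => fittingCost z (S β) := by
    unfold fittingCost
    exact continuous_finsetSum _ fun m _ =>
      continuous_const.mul (((hcont m).sub continuous_const).norm.pow 2)
  have hcomp : CompactSpace (coeffsUpTo K αmax k) :=
    isCompact_iff_compactSpace.1 (isCompact_coeffsUpTo K αmax k)
  have hne : Nonempty (coeffsUpTo K αmax k) := ⟨⟨0, fun j => ⟨le_rfl, hαmax⟩, fun j _ => rfl⟩⟩
  obtain ⟨β', -, hmin⟩ := isCompact_univ.exists_isMinOn univ_nonempty hcost.continuousOn
  refine ⟨β', β'.2, S β', ⟨β'.2, hS β'⟩, fun β y hy => ?_⟩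
  -- Uniqueness of states makes every feasible point lie on the graph of `S`, so minimising over `β`
  -- alone suffices.
  have hyS : y = S ⟨β, hy.1⟩ :=
    funext fun m => (hstate β hy.1 m).unique (hy.2 m) (hS ⟨β, hy.1⟩ m)
  rw [hyS]
  exact hmin (mem_univ _)
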